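/- For $n\ge 4$ let ${}_nw\in\mathfrak S_n$ be the permutation with one-line notation $[n,1,2,\dots,n-4,\,n-2,\,n-1,\,n-3]$. A reduced word of a permutation $w$ is a sequence $a_1a_2\cdots a_p$ with $w=s_{a_1}s_{a_2}\cdots s_{a_p}$, where $s_i$ is the simple transposition $(i\ \,i+1)$ and $p=\ell(w)$ is the number of inversions of $w$. Let $\mathcal G_{{}_nw}$ be the graph whose vertices are the reduced words of ${}_nw$, two of them being adjacent when they differ by one commutation ($\cdots ij\cdots\leftrightarrow\cdots ji\cdots$ with $|i-j|>1$) or one braid relation ($\cdots iji\cdots\leftrightarrow\cdots jij\cdots$ with $|i-j|=1$), and let $P_{\mathcal G_{{}_nw}}(d)=\sum_{v}d^{\deg v}$ (sum over the vertices $v$ of $\mathcal G_{{}_nw}$) be its vertex-degree polynomial. Then, as formal power series in $z$ over $\mathbb Z[d]$ (where $(1-z)^3$ is invertible), $$\sum_{n\ge 4}P_{\mathcal G_{{}_nw}}(d)\,z^n=\frac{z^3\left(d^4z^2-2d^3z^2-d^2z^3+2d^3z+3d^2z^2+2dz^3-4d^2z-4dz^2+2d^2+2dz\right)}{(1-z)^3}-2d^2z^3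 .$$ -/

import Mathlib

open scoped Polynomial PowerSeries

namespace ReducedWords

/-- The simple transposition exchanging the (zero-based) points `i` and `i + 1` of `Fin n`.
With one-based labels this is the generator `s_{i+1}` of the symmetric group. -/
def simpleTransposition {n : ℕ} (i : Fin (n - 1)) : Equiv.Perm (Fin n) :=
  Equiv.swap ⟨i.val, by omega⟩ ⟨i.val + 1, by omega⟩

/-- The length of a permutation: its number of inversions. -/
def length {n : ℕ} (w : Equiv.Perm (Fin n)) : ℕ :=
  (Finset.univ.filter fun p : Fin n × Fin n => p.1 < p.2 ∧ w p.2 < w p.1).card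

/-- `a = a₁ a₂ ⋯ a_p` is a reduced word for `w`: `w = s_{a₁} s_{a₂} ⋯ s_{a_p}` and `p = ℓ(w)`. -/
def IsReducedWord {n : ℕ} (w : Equiv.Perm (Fin n)) (a : List (Fin (n - 1))) : Prop :=
  (a.map simpleTransposition).prod = w ∧ a.length = length w

/-- The set `R(w)` of reduced words of `w`, as a type. -/
def ReducedWord {n : ℕ} (w : Equiv.Perm (Fin n)) : Type :=
  {a : List (Fin (n - 1)) // IsReducedWord w a}

instance {n : ℕ} (w : Equiv.Perm (Fin n)) : Finite (ReducedWord w) :=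
  ((List.finite_length_eq (Fin (n - 1)) (length w)).subset fun _ ha => ha.2).to_subtype

noncomputable instance {n : ℕ} (w : Equiv.Perm (Fin n)) : Fintype (ReducedWord w) :=
  Fintype.ofFinite _

/-- `b` arises from `a` by one commutation: adjacent letters `i j` with `|i - j| > 1` are
exchanged. -/
def CommutationMove {m : ℕ} (a b : List (Fin m)) : Prop :=
  ∃ (u v : List (Fin m)) (i j : Fin m), (i.val + 1 < j.val ∨ j.val + 1 < i.val) ∧
    a = u ++ [i, j] ++ v ∧ b = u ++ [j, i] ++ v

/-- `b` arises from `a` by one braid relation: a factor `i j i` with `|i - j| = 1` is replaced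
by `j i j`. -/
def BraidMove {m : ℕ} (a b : List (Fin m)) : Prop :=
  ∃ (u v : List (Fin m)) (i j : Fin m), (i.val + 1 = j.val ∨ j.val + 1 = i.val) ∧
    a = u ++ [i, j, i] ++ v ∧ b = u ++ [j, i, j] ++ v

/-- The graph of reduced words of `w`: two reduced words are adjacent when they differ by one
commutation or one braid relation. -/
def reducedWordGraph {n : ℕ} (w : Equiv.Perm (Fin n)) : SimpleGraph (ReducedWord w) where
  Adj a b := CommutationMove a.1 b.1 ∨ BraidMove a.1 b.1
  symm := ⟨by
    rintro a b (⟨u, v, i, j, h, h1, h2⟩ | ⟨u, v, i, j, h, h1, h2⟩)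
    · exact Or.inl ⟨u, v, j, i, h.symm, h2, h1⟩
    · exact Or.inr ⟨u, v, j, i, h.symm, h2, h1⟩⟩
  loopless := ⟨by
    rintro a (⟨u, v, i, j, h, h1, h2⟩ | ⟨u, v, i, j, h, h1, h2⟩)
    · have h3 : i = j := by
        have := h1.symm.trans h2
        simp at this
        exact this.1
      subst h3
      omega
    · have h3 : i = j := by
        have := h1.symm.trans h2
        simp at this
        exact this.1
      subst h3
      omega⟩

open Classical in
/-- The vertex-degree polynomial `∑_v d ^ deg v` of a finite graph, in the variable `d`. -/
noncomputable def vertexDegreePolynomial {V : Type*} [Fintype V] (G : SimpleGraph V) : ℤ[X] :=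
  ∑ v : V, Polynomial.X ^ G.degree v

/-- The one-line notation `[n, 1, 2, …, n-4, n-2, n-1, n-3]`, with positions and values shifted
to start at `0`. -/
def hookFun (n : ℕ) (hn : 4 ≤ n) (i : Fin n) : Fin n :=
  if i.val = 0 then ⟨n - 1, by omega⟩
  else if i.val ≤ n - 4 then ⟨i.val - 1, by omega⟩
  else if i.val = n - 1 then ⟨n - 4, by omega⟩
  else i

theorem hookFun_injective (n : ℕ) (hn : 4 ≤ n) : Function.Injective (hookFun n hn) := by
  intro i j h
  have hi := i.isLt
  have hj := j.isLt
  apply Fin.ext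
  unfold hookFun at h
  split_ifs at h <;> simp [Fin.ext_iff] at h <;> omega

/-- The permutation `[n, 1, 2, …, n-4, n-2, n-1, n-3]` of the symmetric group on `n` points. -/
noncomputable def hookPerm (n : ℕ) (hn : 4 ≤ n) : Equiv.Perm (Fin n) :=
  Equiv.ofBijective (hookFun n hn) (Finite.injective_iff_bijective.mp (hookFun_injective n hn))

/-- The formal power series `∑_{n ≥ 4} P_n(d) zⁿ` over `ℤ[d]`, where `P_n` is the vertex-degree
polynomial of the graph of reduced words of `[n, 1, 2, …, n-4, n-2, n-1, n-3]`. -/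
noncomputable def generatingSeries : ℤ[X]⟦X⟧ :=
  PowerSeries.mk fun n =>
    if hn : 4 ≤ n then vertexDegreePolynomial (reducedWordGraph (hookPerm n hn)) else 0

end ReducedWords

/-! Reduced words are read from the last letter, which runs over the right descents. Every
permutation met while stripping letters off ${}_nw$ consists of the value $n$ at position $n-r$,
inserted into an increasing word whose last three entries have been rearranged with $e\in\{0,1,2\}$
inversions (`IsPeelState`). A descent either lets $n$ step right ($r$ drops) or removes an inversion
of the tail ($e$ drops); the second is blocked exactly when $n$ stands between the two tail entries,
that is, $r=3-e$. With letters counted from the right end, the tree of choices `peel` depends on $n$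
only through the initial value $r=n-1$.

The degree of a word is its number of applicable moves, since distinct moves give distinct words
(`degree_reducedWordGraph`). Moves are seen in windows of two or three letters, so the recursion for
the degree sums only has to remember the preceding letter. Let $A_k$ and $B_k$ be the degree sums
over `peel 1 (k + 2)` and `peel 2 (k + 2)`, each word preceded by the letter $k+2$. Then
$A_0=d+d^2$, $B_0=d+d^2+d^3$, $A_{k+1}=A_k+d^2$, $B_{k+1}=B_k+d^2A_k+d^2$, and the polynomial for
$n=k+4$ is $B_k+dA_k+d$. Summing these recurrences as power series gives the formula. -/

namespace ReducedWords

/-! ### Length of permutations and right descents. -/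

section Length

variable {n : ℕ}

theorem simpleTransposition_mul_self (x : Fin (n - 1)) :
    simpleTransposition x * simpleTransposition x = 1 :=
  Equiv.swap_mul_self _ _

theorem simpleTransposition_val (x : Fin (n - 1)) (i : Fin n) :
    (simpleTransposition x i).val =
      if i.val = x.val then x.val + 1 else if i.val = x.val + 1 then x.val else i.val := by
  rw [simpleTransposition, Equiv.swap_apply_def]
  simp only [Fin.ext_iff]
  split_ifs <;> rfl

theorem length_one : length (1 : Equiv.Perm (Fin n)) = 0 := by
  rw [length, Finset.card_eq_zero, Finset.filter_eq_empty_iff]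
  rintro p - ⟨h1, h2⟩
  exact absurd h1 (not_lt.mpr h2.le)

/-- Multiplying by a simple transposition on the right at a descent removes one inversion. -/
theorem length_mul_simpleTransposition_of_descent (w : Equiv.Perm (Fin n)) (x : Fin (n - 1))
    (h : w ⟨x.val + 1, by omega⟩ < w ⟨x.val, by omega⟩) :
    length w = length (w * simpleTransposition x) + 1 := by
  have hx := x.isLt
  have hss : ∀ i, simpleTransposition x (simpleTransposition x i) = i := fun i => by
    rw [← Equiv.Perm.mul_apply, simpleTransposition_mul_self, Equiv.Perm.one_apply]
  have hsx : simpleTransposition x ⟨x.val, by omega⟩ = ⟨x.val + 1, by omega⟩ :=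
    Equiv.swap_apply_left _ _
  have hsx' : simpleTransposition x ⟨x.val + 1, by omega⟩ = ⟨x.val, by omega⟩ :=
    Equiv.swap_apply_right _ _
  have hmono : ∀ i j : Fin n, i < j → ¬ (i.val = x.val ∧ j.val = x.val + 1) →
      simpleTransposition x i < simpleTransposition x j := by
    intro i j hij hne
    rw [Fin.lt_def, simpleTransposition_val, simpleTransposition_val]
    have := Fin.lt_def.mp hij
    split_ifs <;> omega
  set e : Fin n × Fin n := (⟨x.val, by omega⟩, ⟨x.val + 1, by omega⟩) with he
  have hmem : e ∈ Finset.univ.filter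
      fun p : Fin n × Fin n => p.1 < p.2 ∧ w p.2 < w p.1 := by
    simp only [Finset.mem_filter, Finset.mem_univ, true_and, he]
    exact ⟨Fin.lt_def.mpr (Nat.lt_succ_self _), h⟩
  have hne_of : ∀ p : Fin n × Fin n, p ≠ e → ¬ (p.1.val = x.val ∧ p.2.val = x.val + 1) :=
    fun p hp hc => hp (Prod.ext (Fin.ext hc.1) (Fin.ext hc.2))
  rw [length, length, ← Finset.card_erase_add_one hmem]
  congr 1
  refine Finset.card_nbij' (fun p => (simpleTransposition x p.1, simpleTransposition x p.2))
    (fun p => (simpleTransposition x p.1, simpleTransposition x p.2)) ?_ ?_ ?_ ?_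
  · intro p hp
    simp only [Finset.mem_coe, Finset.mem_erase, Finset.mem_filter, Finset.mem_univ,
      true_and] at hp
    simp only [Finset.mem_coe, Finset.mem_filter, Finset.mem_univ, true_and]
    simp only [Equiv.Perm.mul_apply, hss]
    exact ⟨hmono _ _ hp.2.1 (hne_of p hp.1), hp.2.2⟩
  · intro p hp
    simp only [Finset.mem_coe, Finset.mem_filter, Finset.mem_univ, true_and] at hp
    simp only [Equiv.Perm.mul_apply] at hp
    have hpe : p ≠ e := by
      rintro rfl
      have h2 := hp.2
      simp only [he, hsx, hsx'] at h2
      exact lt_asymm h h2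
    simp only [Finset.mem_coe, Finset.mem_erase, Finset.mem_filter, Finset.mem_univ, true_and]
    have hlt := hmono _ _ hp.1 (hne_of p hpe)
    refine ⟨fun hc => ?_, hlt, hp.2⟩
    have h1 : p.1 = ⟨x.val + 1, by omega⟩ := by
      rw [← hss p.1, show simpleTransposition x p.1 = _ from congrArg Prod.fst hc, hsx]
    have h2 : p.2 = ⟨x.val, by omega⟩ := by
      rw [← hss p.2, show simpleTransposition x p.2 = _ from congrArg Prod.snd hc, hsx']
    have := Fin.lt_def.mp hp.1
    simp only [h1, h2] at this
    omega
  · intro p _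
    simp only [hss]
  · intro p _
    simp only [hss]

/-- Multiplying by a simple transposition on the right at an ascent adds one inversion. -/
theorem length_mul_simpleTransposition_of_not_descent (w : Equiv.Perm (Fin n)) (x : Fin (n - 1))
    (h : ¬ w ⟨x.val + 1, by omega⟩ < w ⟨x.val, by omega⟩) :
    length (w * simpleTransposition x) = length w + 1 := by
  have hne : w ⟨x.val + 1, by omega⟩ ≠ w ⟨x.val, by omega⟩ := fun hc => by
    have := Fin.ext_iff.mp (w.injective hc)
    simp only at this
    omega
  have key := length_mul_simpleTransposition_of_descent (w * simpleTransposition x) x (by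
    rw [Equiv.Perm.mul_apply, Equiv.Perm.mul_apply, simpleTransposition, Equiv.swap_apply_right,
      Equiv.swap_apply_left]
    exact lt_of_le_of_ne (not_lt.mp h) hne.symm)
  rwa [mul_assoc, simpleTransposition_mul_self, mul_one] at key

theorem length_prod_le (a : List (Fin (n - 1))) :
    length (a.map simpleTransposition).prod ≤ a.length := by
  induction a using List.reverseRecOn with
  | nil => simp [length_one]
  | append_singleton a x ih =>
    rw [List.map_append, List.prod_append, List.map_singleton, List.prod_singleton,
      List.length_append, List.length_singleton]
    by_cases h : (a.map simpleTransposition).prod ⟨x.val + 1, by omega⟩ <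
        (a.map simpleTransposition).prod ⟨x.val, by omega⟩
    · have := length_mul_simpleTransposition_of_descent _ x h
      omega
    · rw [length_mul_simpleTransposition_of_not_descent _ x h]
      omega

/-- The last letter of a reduced word is a right descent, and removing it leaves a reduced
word. -/
theorem isReducedWord_append_singleton (w : Equiv.Perm (Fin n)) (a : List (Fin (n - 1)))
    (x : Fin (n - 1)) :
    IsReducedWord w (a ++ [x]) ↔ w ⟨x.val + 1, by omega⟩ < w ⟨x.val, by omega⟩ ∧
      IsReducedWord (w * simpleTransposition x) a := by
  have hp : (a.map simpleTransposition).prod * simpleTransposition x = w ↔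
      (a.map simpleTransposition).prod = w * simpleTransposition x := by
    constructor <;> rintro h
    · rw [← h, mul_assoc, simpleTransposition_mul_self, mul_one]
    · rw [h, mul_assoc, simpleTransposition_mul_self, mul_one]
  unfold IsReducedWord
  rw [List.map_append, List.prod_append, List.map_singleton, List.prod_singleton,
    List.length_append, List.length_singleton, hp]
  constructor
  · rintro ⟨h1, h2⟩
    have hd : w ⟨x.val + 1, by omega⟩ < w ⟨x.val, by omega⟩ := by
      by_contra hd
      have h3 := length_mul_simpleTransposition_of_not_descent w x hd
      have h4 := length_prod_le a
      rw [h1] at h4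
      omega
    have := length_mul_simpleTransposition_of_descent w x hd
    exact ⟨hd, h1, by omega⟩
  · rintro ⟨hd, h1, h2⟩
    have := length_mul_simpleTransposition_of_descent w x hd
    exact ⟨h1, by omega⟩

end Length

/-! ### Degrees of reduced words as counts of moves. -/

section Moves

variable {m : ℕ}

/-- The number of positions of a word over `ℕ` at which a commutation or a braid relation
applies. -/
def moveCount : List ℕ → ℕ
  | x :: y :: l => (if x + 1 < y ∨ y + 1 < x then 1 else 0) +
      (if (x + 1 = y ∨ y + 1 = x) ∧ l.head? = some x then 1 else 0) + moveCount (y :: l)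
  | _ => 0

theorem commutationMove_cons_iff (x : Fin m) (l b : List (Fin m)) :
    CommutationMove (x :: l) b ↔ (∃ b', CommutationMove l b' ∧ x :: b' = b) ∨
      ∃ (y : Fin m) (v : List (Fin m)), (x.val + 1 < y.val ∨ y.val + 1 < x.val) ∧
        l = y :: v ∧ b = y :: x :: v := by
  constructor
  · rintro ⟨u, v, i, j, h, h1, h2⟩
    cases u with
    | nil =>
      simp only [List.nil_append, List.cons_append, List.cons.injEq] at h1 h2
      obtain ⟨rfl, h1⟩ := h1
      exact Or.inr ⟨j, v, h, h1, h2⟩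
    | cons c u =>
      simp only [List.cons_append, List.cons.injEq] at h1 h2
      obtain ⟨rfl, h1⟩ := h1
      exact Or.inl ⟨_, ⟨u, v, i, j, h, h1, rfl⟩, h2.symm⟩
  · rintro (⟨b', ⟨u, v, i, j, h, rfl, rfl⟩, rfl⟩ | ⟨y, v, h, rfl, rfl⟩)
    · exact ⟨x :: u, v, i, j, h, rfl, rfl⟩
    · exact ⟨[], v, x, y, h, rfl, rfl⟩

theorem braidMove_cons_iff (x : Fin m) (l b : List (Fin m)) :
    BraidMove (x :: l) b ↔ (∃ b', BraidMove l b' ∧ x :: b' = b) ∨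
      ∃ (y : Fin m) (v : List (Fin m)), (x.val + 1 = y.val ∨ y.val + 1 = x.val) ∧
        l = y :: x :: v ∧ b = y :: x :: y :: v := by
  constructor
  · rintro ⟨u, v, i, j, h, h1, h2⟩
    cases u with
    | nil =>
      simp only [List.nil_append, List.cons_append, List.cons.injEq] at h1 h2
      obtain ⟨rfl, h1⟩ := h1
      exact Or.inr ⟨j, v, h, h1, h2⟩
    | cons c u =>
      simp only [List.cons_append, List.cons.injEq] at h1 h2
      obtain ⟨rfl, h1⟩ := h1
      exact Or.inl ⟨_, ⟨u, v, i, j, h, h1, rfl⟩, h2.symm⟩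
  · rintro (⟨b', ⟨u, v, i, j, h, rfl, rfl⟩, rfl⟩ | ⟨y, v, h, rfl, rfl⟩)
    · exact ⟨x :: u, v, i, j, h, rfl, rfl⟩
    · exact ⟨[], v, x, y, h, rfl, rfl⟩

/-- The words obtained from `a` by one commutation or braid relation. -/
def moveSet (a : List (Fin m)) : Set (List (Fin m)) :=
  {b | CommutationMove a b ∨ BraidMove a b}

theorem moveSet_cons_cons (x y : Fin m) (l : List (Fin m)) :
    moveSet (x :: y :: l) = (List.cons x '' moveSet (y :: l) ∪
      {b | (x.val + 1 < y.val ∨ y.val + 1 < x.val) ∧ b = y :: x :: l}) ∪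
      {b | (x.val + 1 = y.val ∨ y.val + 1 = x.val) ∧ l.head? = some x ∧
        b = y :: x :: y :: l.tail} := by
  ext b
  simp only [moveSet, Set.mem_ofPred_eq, Set.mem_union, Set.mem_image,
    commutationMove_cons_iff x, braidMove_cons_iff x, List.cons.injEq]
  constructor
  · rintro ((⟨b', h, rfl⟩ | ⟨y, v, h, ⟨rfl, rfl⟩, rfl⟩) | (⟨b', h, rfl⟩ | ⟨y, v, h, ⟨rfl, rfl⟩, rfl⟩))
    · exact Or.inl (Or.inl ⟨b', Or.inl h, rfl⟩)
    · exact Or.inl (Or.inr ⟨h, rfl⟩)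
    · exact Or.inl (Or.inl ⟨b', Or.inr h, rfl⟩)
    · exact Or.inr ⟨h, rfl, rfl⟩
  · rintro ((⟨b', h | h, rfl⟩ | ⟨h, rfl⟩) | ⟨h, h', rfl⟩)
    · exact Or.inl (Or.inl ⟨b', h, rfl⟩)
    · exact Or.inr (Or.inl ⟨b', h, rfl⟩)
    · exact Or.inl (Or.inr ⟨y, l, h, ⟨rfl, rfl⟩, rfl⟩)
    · refine Or.inr (Or.inr ⟨y, l.tail, h, ⟨rfl, ?_⟩, rfl⟩)
      cases l with
      | nil => simp at h'
      | cons c l => simpa using h'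

theorem encard_setOf_and_eq {α : Type*} (p : Prop) [Decidable p] (c : α) :
    {b | p ∧ b = c}.encard = ((if p then 1 else 0 : ℕ) : ℕ∞) := by
  split_ifs with h <;> simp [h]

/-- The moves out of a word are counted by `moveCount`; the letters may be relabelled in
reverse order. -/
theorem encard_moveSet {n : ℕ} (a : List (Fin (n - 1))) :
    (moveSet a).encard = moveCount (a.map fun i => n - 2 - i.val) := by
  have hnil : moveSet ([] : List (Fin (n - 1))) = ∅ := by
    ext b
    simp [moveSet, CommutationMove, BraidMove]
  induction a with
  | nil => simp [hnil, moveCount]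
  | cons x l ih =>
    cases l with
    | nil =>
      have : moveSet [x] = ∅ := by
        ext b
        simp only [moveSet, Set.mem_ofPred_eq, commutationMove_cons_iff x, braidMove_cons_iff x]
        simp [CommutationMove, BraidMove]
      simp [this, moveCount]
    | cons y l =>
      have hx := x.isLt
      have hy := y.isLt
      rw [moveSet_cons_cons, Set.encard_union_eq, Set.encard_union_eq,
        List.cons_injective.encard_image, ih]
      · simp only [← and_assoc]
        rw [encard_setOf_and_eq, encard_setOf_and_eq]
        simp only [List.map_cons, moveCount, List.head?_map, Option.map_eq_some_iff]
        have h1 : (n - 2 - x.val + 1 < n - 2 - y.val ∨ n - 2 - y.val + 1 < n - 2 - x.val) ↔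
            (x.val + 1 < y.val ∨ y.val + 1 < x.val) := by omega
        have h2 : (n - 2 - x.val + 1 = n - 2 - y.val ∨ n - 2 - y.val + 1 = n - 2 - x.val) ↔
            (x.val + 1 = y.val ∨ y.val + 1 = x.val) := by omega
        have h3 : (∃ c, l.head? = some c ∧ n - 2 - c.val = n - 2 - x.val) ↔
            l.head? = some x := by
          constructor
          · rintro ⟨c, hc, hcx⟩
            have := c.isLt
            rw [hc, Fin.ext (by omega : c.val = x.val)]
          · exact fun h => ⟨x, h, rfl⟩
        simp only [h1, h2, h3]
        push_cast
        ring
      -- A move at the front replaces the first letter `x` by `y ≠ x`, while a move further on keeps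
      -- it; commutation and braid at the front exclude each other through `|x - y|`.
      · rw [Set.disjoint_left]
        rintro _ ⟨b, -, rfl⟩ ⟨h, hb⟩
        rw [List.cons.injEq] at hb
        rw [hb.1] at h
        omega
      · rw [Set.disjoint_left]
        rintro _ (⟨b, -, rfl⟩ | ⟨h, rfl⟩) ⟨h', -, hb⟩
        · rw [List.cons.injEq] at hb
          rw [hb.1] at h'
          omega
        · omega

theorem reverse_mem_moveSet {a b : List (Fin m)} (h : b ∈ moveSet a) :
    b.reverse ∈ moveSet a.reverse := by
  rcases h with ⟨u, v, i, j, h, rfl, rfl⟩ | ⟨u, v, i, j, h, rfl, rfl⟩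
  · exact Or.inl ⟨v.reverse, u.reverse, j, i, h.symm, by simp, by simp⟩
  · exact Or.inr ⟨v.reverse, u.reverse, i, j, h, by simp, by simp⟩

theorem encard_moveSet_reverse (a : List (Fin m)) :
    (moveSet a.reverse).encard = (moveSet a).encard := by
  rw [← List.reverse_injective.encard_image (moveSet a)]
  congr 1
  ext b
  constructor
  · intro h
    exact ⟨b.reverse, by simpa using reverse_mem_moveSet h, b.reverse_reverse⟩
  · rintro ⟨c, h, rfl⟩
    exact reverse_mem_moveSet h

theorem simpleTransposition_commute {n : ℕ} (i j : Fin (n - 1))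
    (h : i.val + 1 < j.val ∨ j.val + 1 < i.val) :
    simpleTransposition i * simpleTransposition j =
      simpleTransposition j * simpleTransposition i := by
  ext k
  simp only [Equiv.Perm.mul_apply, simpleTransposition_val]
  split_ifs <;> omega

theorem simpleTransposition_braid {n : ℕ} (i j : Fin (n - 1))
    (h : i.val + 1 = j.val ∨ j.val + 1 = i.val) :
    simpleTransposition i * (simpleTransposition j * simpleTransposition i) =
      simpleTransposition j * (simpleTransposition i * simpleTransposition j) := by
  wlog hij : i.val + 1 = j.val generalizing i j
  · exact (this j i h.symm (h.resolve_left hij)).symm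
  obtain ⟨i, hi⟩ := i
  obtain ⟨j, hj⟩ := j
  obtain rfl : i + 1 = j := hij
  rw [← mul_assoc, ← mul_assoc]
  simp only [simpleTransposition]
  rw [Equiv.swap_mul_swap_mul_swap (by simp) (by simp; omega),
    Equiv.swap_comm (⟨i, _⟩ : Fin n) ⟨i + 1, _⟩,
    Equiv.swap_comm (⟨i + 1, _⟩ : Fin n) ⟨i + 1 + 1, _⟩,
    Equiv.swap_mul_swap_mul_swap (by simp) (by simp; omega), Equiv.swap_comm]

/-- Ensures that every word counted by `moveSet` is a vertex of the graph. -/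
theorem IsReducedWord.of_mem_moveSet {n : ℕ} {w : Equiv.Perm (Fin n)} {a b : List (Fin (n - 1))}
    (ha : IsReducedWord w a) (h : b ∈ moveSet a) : IsReducedWord w b := by
  obtain ⟨h1, h2⟩ := ha
  rcases h with ⟨u, v, i, j, h, rfl, rfl⟩ | ⟨u, v, i, j, h, rfl, rfl⟩
  · refine ⟨?_, by simpa using h2⟩
    rw [← h1]
    simp only [List.map_append, List.prod_append, List.map_cons, List.map_nil, List.prod_cons,
      List.prod_nil, mul_one, simpleTransposition_commute i j h]
  · refine ⟨?_, by simpa using h2⟩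
    rw [← h1]
    simp only [List.map_append, List.prod_append, List.map_cons, List.map_nil, List.prod_cons,
      List.prod_nil, mul_one, simpleTransposition_braid i j h]

open Classical in
/-- The degree of a reduced word, computed from the reversed and relabelled word. -/
theorem degree_reducedWordGraph {n : ℕ} {w : Equiv.Perm (Fin n)} (v : ReducedWord w) :
    (reducedWordGraph w).degree v = moveCount (v.1.reverse.map fun i => n - 2 - i.val) := by
  have h : Subtype.val '' (reducedWordGraph w).neighborSet v = moveSet v.1 := by
    ext b
    constructor
    · rintro ⟨b, hb, rfl⟩
      exact hb
    · exact fun hb => ⟨⟨b, v.2.of_mem_moveSet hb⟩, hb, rfl⟩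
  have h' := congrArg Set.encard h
  rw [show (Subtype.val '' (reducedWordGraph w).neighborSet v).encard = _ from
    Function.Injective.encard_image (f := (Subtype.val : ReducedWord w → _))
      Subtype.val_injective _, ← encard_moveSet_reverse, encard_moveSet,
    ← SimpleGraph.coe_neighborFinset] at h'
  have h2 := Set.encard_coe_eq_coe_finsetCard ((reducedWordGraph w).neighborFinset v)
  have h3 := h2.symm.trans h'
  exact_mod_cast h3

end Moves

/-! ### Reduced words obtained by stripping right descents. -/

section Peeling

/-- `peel e r` lists the reversed and relabelled reduced words (the letter `i` becoming
`n - 2 - i`) of a permutation satisfying `IsPeelState r e`. -/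
def peel : ℕ → ℕ → List (List ℕ)
  | 0, 0 => [[]]
  | 0, r + 1 => (peel 0 r).map (List.cons r)
  | e + 1, 0 => (peel e 0).map (List.cons (2 - e))
  | e + 1, r + 1 => (peel (e + 1) r).map (List.cons r) ++
      if r + 1 = 2 - e then [] else
        (peel e (r + 1)).map (List.cons (if 2 - e < r + 1 then 1 - e else 2 - e))

theorem nil_mem_peel (e r : ℕ) : [] ∈ peel e r ↔ e = 0 ∧ r = 0 := by
  rcases e with _ | e <;> rcases r with _ | r <;> simp [peel]

/-- Merges the four clauses of `peel` into its two kinds of step. The bound on `e` keeps `3 - e`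
positive, so the blocking condition never holds at `r = 0`. -/
theorem cons_mem_peel (e r y : ℕ) (l : List ℕ) (he : e ≤ 2) : y :: l ∈ peel e r ↔
    (1 ≤ r ∧ y = r - 1 ∧ l ∈ peel e (r - 1)) ∨
      (1 ≤ e ∧ r ≠ 3 - e ∧ y = (if 3 - e < r then 2 - e else 3 - e) ∧ l ∈ peel (e - 1) r) := by
  have h3 : ∀ e, 3 - (e + 1) = 2 - e := by omega
  have h2 : ∀ e, 2 - (e + 1) = 1 - e := by omega
  have hmap : ∀ (c : ℕ) (s : List (List ℕ)), y :: l ∈ s.map (List.cons c) ↔ y = c ∧ l ∈ s := by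
    intro c s
    simp [eq_comm, and_comm]
  rcases e with _ | e <;> rcases r with _ | r
  · simp [peel]
  · simp [peel, hmap]
  · have h0 : 0 ≠ 2 - e := by omega
    simp [peel, hmap, h3, h0]
  · rw [peel, h3, h2]
    by_cases h : r + 1 = 2 - e
    · rw [if_pos h, List.append_nil, hmap]
      constructor
      · rintro ⟨hy, hl⟩
        exact Or.inl ⟨by omega, hy, hl⟩
      · rintro (⟨-, hy, hl⟩ | ⟨-, hr, -⟩)
        · exact ⟨hy, hl⟩
        · exact absurd h hr
    · simp [h, hmap]

/-- The two branches start with different letters. -/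
theorem peel_nodup (e r : ℕ) (he : e ≤ 2) : (peel e r).Nodup := by
  induction e generalizing r with
  | zero =>
    induction r with
    | zero => simp [peel]
    | succ r ih =>
      rw [peel]
      exact ih.map List.cons_injective
  | succ e ihe =>
    induction r with
    | zero =>
      rw [peel]
      exact (ihe 0 (by omega)).map List.cons_injective
    | succ r ih =>
      rw [peel]
      split_ifs with h h'
      · simpa using ih.map List.cons_injective
      all_goals
        refine (ih.map List.cons_injective).append
          ((ihe _ (by omega)).map List.cons_injective) ?_
        intro l hl hl'
        rw [List.mem_map] at hl hl'
        obtain ⟨_, -, rfl⟩ := hl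
        obtain ⟨_, -, h2⟩ := hl'
        rw [List.cons.injEq] at h2
        omega

variable {n : ℕ}

/-- The one-line notation `[1, …, n - 1]` (`e = 0`) with the first two of its last three entries
exchanged (`e = 1`) or its last three entries permuted cyclically (`e = 2`), starting from `0`. -/
def tailFun (n e j : ℕ) : ℕ :=
  if e = 0 then j
  else if e = 1 then (if j = n - 4 then n - 3 else if j = n - 3 then n - 4 else j)
  else if j = n - 4 then n - 3 else if j = n - 3 then n - 2 else if j = n - 2 then n - 4 else j

theorem tailFun_lt {e j : ℕ} (hn : 4 ≤ n) (hj : j < n - 1) : tailFun n e j < n - 1 := by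
  unfold tailFun
  split_ifs <;> omega

theorem tailFun_descent_iff {e j : ℕ} (hn : 4 ≤ n) (hj : j < n - 2) (he : e ≤ 2) :
    tailFun n e (j + 1) < tailFun n e j ↔ 1 ≤ e ∧ j + 5 = n + e := by
  unfold tailFun
  split_ifs <;> omega

/-- The tail has a single descent, at index `n + e - 5`; exchanging the two entries there lowers `e`
by one. -/
theorem tailFun_pred (hn : 4 ≤ n) {e : ℕ} (he : e ≤ 2) (h1 : 1 ≤ e) (j : ℕ) :
    tailFun n (e - 1) j = tailFun n e
      (if j + 5 = n + e then j + 1 else if j + 4 = n + e then j - 1 else j) := by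
  obtain ⟨m, rfl⟩ : ∃ m, n = m + 4 := ⟨n - 4, by omega⟩
  have hm : m + 4 - 4 = m ∧ m + 4 - 3 = m + 1 ∧ m + 4 - 2 = m + 2 := by omega
  unfold tailFun
  simp only [hm]
  obtain h | h | h | h : j = m ∨ j = m + 1 ∨ j = m + 2 ∨ (j < m ∨ m + 2 < j) := by omega
  all_goals
    obtain rfl | rfl : e = 1 ∨ e = 2 := by omega
  all_goals first
    | (subst h; simp <;> omega)
    | have h0 : j ≠ m ∧ j ≠ m + 1 ∧ j ≠ m + 2 := by omega
      simp [h0]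

/-- In one-line notation, `w` has the value `n` at position `n - r`, and its other entries are
given by `tailFun n e`. -/
def IsPeelState (r e : ℕ) (w : Equiv.Perm (Fin n)) : Prop :=
  ∀ i : Fin n, (w i).val = if i.val = n - 1 - r then n - 1 else
    tailFun n e (if i.val < n - 1 - r then i.val else i.val - 1)

theorem isPeelState_hookPerm (hn : 4 ≤ n) : IsPeelState (n - 1) 2 (hookPerm n hn) := by
  intro i
  have := i.isLt
  simp only [hookPerm, Equiv.ofBijective_apply, hookFun, tailFun]
  split_ifs <;> (try simp only) <;> first | omega | contradiction

/-- The step up to the maximal value is an ascent and the step down from it a descent. Any other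
descent is that of the tail, one position further right when the maximal value precedes it, and
destroyed when the maximal value splits it. -/
theorem IsPeelState.descent_iff {r e : ℕ} {w : Equiv.Perm (Fin n)} (h : IsPeelState r e w)
    (hn : 4 ≤ n) (hr : r ≤ n - 1) (he : e ≤ 2) (x : Fin (n - 1)) :
    w ⟨x.val + 1, by omega⟩ < w ⟨x.val, by omega⟩ ↔ (1 ≤ r ∧ n - 2 - x.val = r - 1) ∨
      (1 ≤ e ∧ r ≠ 3 - e ∧ n - 2 - x.val = (if 3 - e < r then 2 - e else 3 - e)) := by
  have hx := x.isLt
  rw [Fin.lt_def, h, h]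
  simp only
  rcases lt_trichotomy x.val (n - 1 - r) with hlt | heq | hgt
  · by_cases hs : x.val + 1 = n - 1 - r
    · have := tailFun_lt (e := e) hn (show x.val < n - 1 by omega)
      rw [if_pos hs, if_neg hlt.ne, if_pos hlt]
      split_ifs <;> omega
    · rw [if_neg hs, if_neg hlt.ne, if_pos hlt, if_pos (by omega),
        tailFun_descent_iff hn (by omega) he]
      split_ifs <;> omega
  · have := tailFun_lt (e := e) hn (show x.val < n - 1 by omega)
    rw [if_pos heq, if_neg (by omega), if_neg (by omega), Nat.add_sub_cancel]
    simp only [this, true_iff]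
    omega
  · obtain ⟨y, hy⟩ : ∃ y, x.val = y + 1 := ⟨x.val - 1, by omega⟩
    rw [if_neg (by omega), if_neg (by omega), if_neg (by omega), if_neg (by omega), hy,
      Nat.add_sub_cancel, Nat.add_sub_cancel, tailFun_descent_iff hn (by omega) he]
    split_ifs <;> omega

theorem IsPeelState.mul_left {r e : ℕ} {w : Equiv.Perm (Fin n)} (h : IsPeelState r e w)
    (x : Fin (n - 1)) (h1 : 1 ≤ r)
    (hx : n - 2 - x.val = r - 1) : IsPeelState (r - 1) e (w * simpleTransposition x) := by
  have hx' := x.isLt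
  intro i
  rw [Equiv.Perm.mul_apply, h, simpleTransposition_val]
  split_ifs <;> first | omega | rfl | (congr 1; omega)

theorem IsPeelState.mul_right {r e : ℕ} {w : Equiv.Perm (Fin n)} (h : IsPeelState r e w)
    (hn : 4 ≤ n) (he : e ≤ 2) (x : Fin (n - 1)) (h1 : 1 ≤ e) (hre : r ≠ 3 - e)
    (hx : n - 2 - x.val = (if 3 - e < r then 2 - e else 3 - e)) :
    IsPeelState r (e - 1) (w * simpleTransposition x) := by
  have hx' := x.isLt
  intro i
  have hi := i.isLt
  rw [Equiv.Perm.mul_apply, h, simpleTransposition_val, tailFun_pred hn he h1]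
  have key : ∀ a b, a = b → tailFun n e a = tailFun n e b := fun a b => congrArg _
  split_ifs at hx ⊢ <;> first | omega | (apply key; omega)

/-- The reduced words of a permutation satisfying `IsPeelState r e`. -/
theorem isReducedWord_reverse_iff (hn : 4 ≤ n) (l : List (Fin (n - 1))) :
    ∀ (r e : ℕ) (w : Equiv.Perm (Fin n)), IsPeelState r e w → r ≤ n - 1 → e ≤ 2 →
      (IsReducedWord w l.reverse ↔ (l.map fun i => n - 2 - i.val) ∈ peel e r) := by
  induction l with
  | nil =>
    intro r e w h hr he
    rw [List.map_nil, nil_mem_peel]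
    constructor
    · rintro ⟨h1, -⟩
      simp only [List.reverse_nil, List.map_nil, List.prod_nil] at h1
      subst h1
      -- For the identity, the position of the maximal value forces `r = 0`; the entry at `n - 4`,
      -- which any `e ≥ 1` would disturb, then forces `e = 0`.
      have ha := h ⟨n - 1 - r, by omega⟩
      have hb := h ⟨n - 4, by omega⟩
      simp only [Equiv.Perm.one_apply, if_true, tailFun] at ha hb
      split_ifs at hb <;> omega
    · rintro ⟨rfl, rfl⟩
      have : w = 1 := by
        ext i
        have := i.isLt
        rw [h, Equiv.Perm.one_apply, tailFun, if_pos rfl]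
        split_ifs <;> omega
      subst this
      exact ⟨by simp, by simp [length_one]⟩
  | cons x l ih =>
    intro r e w h hr he
    rw [List.reverse_cons, isReducedWord_append_singleton, h.descent_iff hn hr he, List.map_cons,
      cons_mem_peel _ _ _ _ he]
    constructor
    · rintro ⟨⟨h1, h2⟩ | ⟨h1, h2, h3⟩, hw⟩
      · exact Or.inl ⟨h1, h2,
          (ih _ _ _ (h.mul_left x h1 h2) (by omega) he).mp hw⟩
      · exact Or.inr ⟨h1, h2, h3,
          (ih _ _ _ (h.mul_right hn he x h1 h2 h3) hr (by omega)).mp hw⟩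
    · rintro (⟨h1, h2, hw⟩ | ⟨h1, h2, h3, hw⟩)
      · exact ⟨Or.inl ⟨h1, h2⟩,
          (ih _ _ _ (h.mul_left x h1 h2) (by omega) he).mpr hw⟩
      · exact ⟨Or.inr ⟨h1, h2, h3⟩,
          (ih _ _ _ (h.mul_right hn he x h1 h2 h3) hr (by omega)).mpr hw⟩

end Peeling

/-! ### Recurrences for the degree sums. -/

section Enumeration

open Polynomial

/-- The sum of `X ^ moveCount (u ++ l)` over the words `l` in a list. -/
noncomputable def weight (u : List ℕ) (s : List (List ℕ)) : ℤ[X] :=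
  (s.map fun l => X ^ moveCount (u ++ l)).sum

theorem weight_append (u : List ℕ) (s t : List (List ℕ)) :
    weight u (s ++ t) = weight u s + weight u t := by
  simp [weight]

theorem weight_map_cons (u : List ℕ) (c : ℕ) (s : List (List ℕ)) :
    weight u (s.map (List.cons c)) = weight (u ++ [c]) s := by
  simp [weight, Function.comp_def]

theorem vertexDegreePolynomial_hookPerm (n : ℕ) (hn : 4 ≤ n) :
    vertexDegreePolynomial (reducedWordGraph (hookPerm n hn)) = weight [] (peel 2 (n - 1)) := by
  classical
  have hkey := fun l => isReducedWord_reverse_iff hn l _ _ _ (isPeelState_hookPerm hn) le_rfl le_rfl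
  -- With letters at most `n - 2`, the relabelling `i ↦ n - 2 - i` can be undone, which gives
  -- surjectivity below.
  have hbound : ∀ (l : List ℕ) (e r : ℕ), e ≤ 2 → r ≤ n - 1 → l ∈ peel e r →
      ∀ x ∈ l, x ≤ n - 2 := by
    intro l
    induction l with
    | nil => simp
    | cons y l ih =>
      intro e r he hr hl x hx
      rw [cons_mem_peel _ _ _ _ he] at hl
      rcases hl with ⟨h1, h2, h3⟩ | ⟨h1, h2, h3, h4⟩
      · rcases List.mem_cons.mp hx with rfl | hx
        · omega
        · exact ih e (r - 1) he (by omega) h3 x hx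
      · rcases List.mem_cons.mp hx with rfl | hx
        · split_ifs at h3 <;> omega
        · exact ih (e - 1) r (by omega) hr h4 x hx
  rw [vertexDegreePolynomial, weight, ← List.sum_toFinset _ (peel_nodup 2 (n - 1) le_rfl)]
  refine Finset.sum_bij (fun v _ => v.1.reverse.map fun i => n - 2 - i.val) ?_ ?_ ?_ ?_
  · intro v _
    rw [List.mem_toFinset, ← hkey, List.reverse_reverse]
    exact v.2
  · intro v _ v' _ h
    refine Subtype.ext (List.reverse_injective (List.map_injective_iff.mpr ?_ h))
    intro i j hij
    have := i.isLt
    have := j.isLt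
    simp only at hij
    exact Fin.ext (by omega)
  · intro l hl
    rw [List.mem_toFinset] at hl
    have hb := hbound l _ _ le_rfl le_rfl hl
    obtain ⟨a, rfl⟩ : ∃ a : List (Fin (n - 1)), (a.map fun i => n - 2 - i.val) = l := by
      clear hl
      induction l with
      | nil => exact ⟨[], rfl⟩
      | cons y l ih =>
        obtain ⟨a, rfl⟩ := ih fun x hx => hb x (List.mem_cons_of_mem _ hx)
        have hy := hb y List.mem_cons_self
        refine ⟨⟨n - 2 - y, by omega⟩ :: a, ?_⟩
        rw [List.map_cons]
        congr 1
        simp only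
        omega
    exact ⟨⟨a.reverse, (hkey a).mpr hl⟩, Finset.mem_univ _, by simp⟩
  · intro v _
    rw [List.nil_append, ← degree_reducedWordGraph]

theorem head_of_mem_peel {e r c : ℕ} {l : List ℕ} (he : e ≤ 2) (hl : l ∈ peel e r)
    (hc : l.head? = some c) :
    c = r - 1 ∨ (1 ≤ e ∧ r ≠ 3 - e ∧ c = (if 3 - e < r then 2 - e else 3 - e)) := by
  cases l with
  | nil => simp at hc
  | cons y l =>
    obtain rfl : y = c := by simpa using hc
    rcases (cons_mem_peel _ _ _ _ he).mp hl with ⟨-, h, -⟩ | ⟨h1, h2, h3, -⟩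
    · exact Or.inl h
    · exact Or.inr ⟨h1, h2, h3⟩

/-- A letter `c` in front of `d :: l` can only add a commutation with `d` or a braid `c d c`; the
hypothesis on heads excludes the braid. -/
theorem weight_pair (c d : ℕ) (s : List (List ℕ)) (h : ∀ l ∈ s, l.head? ≠ some c) :
    weight [c, d] s = X ^ (if c + 1 < d ∨ d + 1 < c then 1 else 0) * weight [d] s := by
  rw [weight, weight, ← List.sum_map_mul_left]
  congr 1
  refine List.map_congr_left fun l hl => ?_
  simp only [List.cons_append, List.nil_append]
  have h0 : ¬ ((c + 1 = d ∨ d + 1 = c) ∧ l.head? = some c) := fun hc => h l hl hc.2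
  rw [moveCount, if_neg h0, add_zero, pow_add]

/-- The only word is the descending run `r - 1, …, 1, 0`, which admits no move. -/
theorem weight_nil_peel_zero (r : ℕ) : weight [] (peel 0 r) = 1 := by
  induction r with
  | zero => simp [weight, peel, moveCount]
  | succ r ih =>
    cases r with
    | zero => simp [weight, peel, moveCount]
    | succ r =>
      rw [peel, weight_map_cons] at ih
      rw [peel, weight_map_cons, peel, weight_map_cons]
      change weight [r + 1, r] (peel 0 r) = 1
      rw [weight_pair, if_neg (by omega), pow_zero, one_mul]
      · exact ih
      · intro l hl hc
        have := head_of_mem_peel (by omega) hl hc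
        omega

/-- The single move is the braid `1 2 1` when `k = 0`, and the commutation of `1` with `k + 2`
otherwise. -/
theorem weight_one_peel_zero (k : ℕ) : weight [1] (peel 0 (k + 3)) = X := by
  cases k with
  | zero => simp [weight, peel, moveCount]
  | succ k =>
    have h := weight_nil_peel_zero (k + 4)
    rw [peel, weight_map_cons] at h ⊢
    change weight [1, k + 3] (peel 0 (k + 3)) = X
    rw [weight_pair, if_pos (by omega), pow_one]
    · exact (congrArg (X * ·) h).trans (mul_one _)
    · intro l hl hc
      have := head_of_mem_peel (by omega) hl hc
      omega

/-- Once `r ≥ 3`, the maximal value stands left of all three tail entries, so the tail step is never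
blocked and its letter no longer depends on `r`. -/
theorem peel_one_add_three (k : ℕ) : peel 1 (k + 3) =
    (peel 1 (k + 2)).map (List.cons (k + 2)) ++ (peel 0 (k + 3)).map (List.cons 1) := by
  rw [show peel 1 (k + 3) = _ from peel.eq_4 0 (k + 2), if_neg (by omega), if_pos (by omega)]

theorem peel_two_add_three (k : ℕ) : peel 2 (k + 3) =
    (peel 2 (k + 2)).map (List.cons (k + 2)) ++ (peel 1 (k + 3)).map (List.cons 0) := by
  rw [peel, if_neg (by omega), if_pos (by omega)]

theorem weight_peel_one_zero : weight [2] (peel 1 2) = X + X ^ 2 := by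
  simp [weight, peel, moveCount]

/-- The letter `k + 3` does not commute with `k + 2` but does with `1`, which gives one factor `X`;
the other comes from `weight_one_peel_zero`. -/
theorem weight_peel_one_succ (k : ℕ) :
    weight [k + 3] (peel 1 (k + 3)) = weight [k + 2] (peel 1 (k + 2)) + X ^ 2 := by
  rw [peel_one_add_three, weight_append, weight_map_cons, weight_map_cons]
  change weight [k + 3, k + 2] _ + weight [k + 3, 1] _ = _
  rw [weight_pair, weight_pair, if_neg (by omega), if_pos (by omega), weight_one_peel_zero]
  · ring
  all_goals
    intro l hl hc
    have := head_of_mem_peel (by omega) hl hc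
    split_ifs at this <;> omega

theorem weight_zero_peel_one (k : ℕ) :
    weight [0] (peel 1 (k + 3)) = X * weight [k + 2] (peel 1 (k + 2)) + X := by
  rw [peel_one_add_three, weight_append, weight_map_cons, weight_map_cons]
  change weight [0, k + 2] _ + weight [0, 1] _ = _
  rw [weight_pair, weight_pair, if_pos (by omega), if_neg (by omega), weight_one_peel_zero]
  · ring
  all_goals
    intro l hl hc
    have := head_of_mem_peel (by omega) hl hc
    split_ifs at this <;> (try simp only [and_false, or_false] at this) <;> omega

theorem weight_peel_two_zero : weight [2] (peel 2 2) = X + X ^ 2 + X ^ 3 := by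
  simp [weight, peel, moveCount]
  ring

theorem weight_peel_two_succ (k : ℕ) :
    weight [k + 3] (peel 2 (k + 3)) = weight [k + 2] (peel 2 (k + 2)) +
      X * (X * weight [k + 2] (peel 1 (k + 2)) + X) := by
  rw [peel_two_add_three, weight_append, weight_map_cons, weight_map_cons]
  change weight [k + 3, k + 2] _ + weight [k + 3, 0] _ = _
  rw [weight_pair, weight_pair, if_neg (by omega), if_pos (by omega), weight_zero_peel_one]
  · ring
  all_goals
    intro l hl hc
    have := head_of_mem_peel (by omega) hl hc
    split_ifs at this <;> (try simp only [and_false, or_false] at this) <;> omega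

theorem weight_nil_peel_two (k : ℕ) :
    weight [] (peel 2 (k + 3)) = weight [k + 2] (peel 2 (k + 2)) +
      (X * weight [k + 2] (peel 1 (k + 2)) + X) := by
  rw [peel_two_add_three, weight_append, weight_map_cons, weight_map_cons, List.nil_append,
    List.nil_append, weight_zero_peel_one]

end Enumeration

/-! ### Solving the recurrences with power series. -/

section Series

theorem mk_eq_C_add_X_mul {R : Type*} [CommRing R] (f : ℕ → R) :
    PowerSeries.mk f = PowerSeries.C (f 0) +
      PowerSeries.X * PowerSeries.mk fun k => f (k + 1) := by
  ext k
  cases k <;> simp [PowerSeries.coeff_succ_X_mul]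

theorem generatingSeries_eq : generatingSeries = PowerSeries.X ^ 4 *
    PowerSeries.mk fun k => weight [] (peel 2 (k + 3)) := by
  ext1 n
  rw [generatingSeries, PowerSeries.coeff_mk, PowerSeries.coeff_X_pow_mul']
  split_ifs with hn
  · rw [vertexDegreePolynomial_hookPerm, PowerSeries.coeff_mk,
      show n - 4 + 3 = n - 1 by omega]
  · rfl

theorem generatingSeries_mul (d z : ℤ[X]⟦X⟧) (hd : d = PowerSeries.C (Polynomial.X : ℤ[X]))
    (hz : z = PowerSeries.X) :
    (generatingSeries + 2 * d ^ 2 * z ^ 3) * (1 - z) ^ 3 =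
      (d ^ 4 * z ^ 2 - 2 * d ^ 3 * z ^ 2 - d ^ 2 * z ^ 3 + 2 * d ^ 3 * z + 3 * d ^ 2 * z ^ 2
          + 2 * d * z ^ 3 - 4 * d ^ 2 * z - 4 * d * z ^ 2 + 2 * d ^ 2 + 2 * d * z) * z ^ 3 := by
  set S : ℤ[X]⟦X⟧ := PowerSeries.mk fun _ => 1 with hS
  set A : ℤ[X]⟦X⟧ := PowerSeries.mk fun k => weight [k + 2] (peel 1 (k + 2)) with hA
  set B : ℤ[X]⟦X⟧ := PowerSeries.mk fun k => weight [k + 2] (peel 2 (k + 2)) with hB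
  have eS : S = 1 + z * S := by
    conv_lhs => rw [hS, mk_eq_C_add_X_mul]
    rw [hz, map_one]
  have eA : A = d + d ^ 2 + z * (A + d ^ 2 * S) := by
    conv_lhs => rw [hA, mk_eq_C_add_X_mul]
    rw [weight_peel_one_zero, map_add, map_pow, ← hd, ← hz]
    congr 2
    ext1 k
    rw [PowerSeries.coeff_mk, weight_peel_one_succ, map_add, hd, ← map_pow,
      PowerSeries.coeff_C_mul]
    simp [hA, hS]
  have eB : B = d + d ^ 2 + d ^ 3 + z * (B + d * (d * A + d * S)) := by
    conv_lhs => rw [hB, mk_eq_C_add_X_mul]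
    rw [weight_peel_two_zero, map_add, map_add, map_pow, map_pow, ← hd, ← hz]
    congr 2
    ext1 k
    rw [PowerSeries.coeff_mk, weight_peel_two_succ, map_add, hd, PowerSeries.coeff_C_mul,
      map_add, PowerSeries.coeff_C_mul, PowerSeries.coeff_C_mul]
    simp [hA, hS, hB]
  have eF : generatingSeries = z ^ 4 * (B + (d * A + d * S)) := by
    rw [generatingSeries_eq, hz]
    congr 1
    ext1 k
    rw [PowerSeries.coeff_mk, weight_nil_peel_two, map_add, map_add, hd,
      PowerSeries.coeff_C_mul, PowerSeries.coeff_C_mul]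
    simp [hA, hS, hB]
  rw [eF]
  -- Each of `eB`, `eA`, `eS` determines `1 - z` times its unknown. The multipliers eliminate `B`,
  -- then `A`, then `S`: each is the coefficient of the unknown accumulated so far, divided by `1 -
  -- z`.
  linear_combination z ^ 4 * ((1 - z) ^ 2 * eB +
    ((1 - z) * z * d ^ 2 + d * (1 - z) ^ 2) * eA +
    ((1 - z) * z * d ^ 2 + (z * d ^ 2 + d * (1 - z)) * z * d ^ 2 + d * (1 - z) ^ 2) * eS)

end Series

end ReducedWords

theorem mainTheorem5 (d z : ℤ[X]⟦X⟧)
    (hd : d = PowerSeries.C (Polynomial.X : ℤ[X])) (hz : z = PowerSeries.X) :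
    IsUnit ((1 - z) ^ 3) ∧
    ReducedWords.generatingSeries =
      (d ^ 4 * z ^ 2 - 2 * d ^ 3 * z ^ 2 - d ^ 2 * z ^ 3 + 2 * d ^ 3 * z + 3 * d ^ 2 * z ^ 2
          + 2 * d * z ^ 3 - 4 * d ^ 2 * z - 4 * d * z ^ 2 + 2 * d ^ 2 + 2 * d * z) * z ^ 3
        * Ring.inverse ((1 - z) ^ 3)
      - 2 * d ^ 2 * z ^ 3 := by
  have hu : IsUnit ((1 - z) ^ 3) := by
    rw [PowerSeries.isUnit_iff_constantCoeff, hz]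
    simp
  refine ⟨hu, ?_⟩
  rw [← ReducedWords.generatingSeries_mul d z hd hz, mul_assoc, Ring.mul_inverse_cancel _ hu]
  ring
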